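/- **DEC-NN-NPAE is consistent.** *Model.* Let $D\ge 1$, $l_1,\dots,l_D,\sigma_f,\sigma_\epsilon>0$, and let $k(x,x')=\sigma_f^2\exp\{-\sum_{d=1}^D (x_d-x'_d)^2/l_d^2\}$ on $\mathbb R^D$. There are $M$ agents ($M$ fixed and known). For each $n$, agent $i$ holds $n$ observations $y_i=(y_{i,a})_{a\le n}$, $y_{i,a}=f(x_{i,a})+\epsilon_{i,a}$, at deterministic inputs $X_i=(x_{i,a})_{a\le n}$ (inputs and noise may depend on $n$); the total number of observations is $N=Mn$. Here $f$ is a centred Gaussian process with covariance $k$, and the $\epsilon_{i,a}$ are i.i.d. $\mathcal N(0,\sigma_\epsilon^2)$ and independent of $f$. Assume that the data of every agent fill some region: for each $i$ there is a nonempty open set $U_i\subseteq\mathbb R^D$ such that every ball centred at a point of $U_i$ contains an input of agent $i$ for all sufficiently large $n$. *Full GP and sub-models.* With $C=k(X,X)+\sigma_\epsilon^2I$ the covariance matrix of all $N$ observations, $\mu_{\rm full}(x_*)=k(X,x_*)^\top C^{-1}y$ and $\sigma^2_{\rm full}(x_*)=k(x_*,x_*)-k(X,x_*)^\top C^{-1}k(X,x_*)$.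 Let $C_{ij}=\mathrm{Cov}(y_i,y_j)$ be the blocks of $C$ (so $C_{ij}=k(X_i,X_j)$ for $i\ne j$, and $C_i=C_{ii}=k(X_i,X_i)+\sigma_\epsilon^2I$), $k_{i,*}=k(X_i,x_*)$, and $$\mu_i=k_{i,*}^\top C_i^{-1}y_i,\qquad [k_A]_i=k_{i,*}^\top C_i^{-1}k_{i,*},\qquad [C_A]_{ij}=k_{i,*}^\top C_i^{-1}C_{ij}C_j^{-1}k_{j,*}.$$ *Network.* The agents communicate over undirected graphs $\mathcal G(t)$, $t=0,1,2,\dots$, on the $M$ agents, each agent also being a neighbour of itself, and the graph is repeatedly strongly connected: there is $\gamma\ge1$ such that for every $t\ge 0$ the union of $\mathcal G(t\gamma),\dots,\mathcal G((t+1)\gamma-1)$ is connected. *Algorithm.* (CBNN) Given a threshold $\eta<\sigma_f^2$ and a location $x_*$, only the agents in $\mathcal V_{\rm NN}=\{i:[k_A]_i\ge\eta\}$ take part. Let $H$, $\kappa$, $\mu$ be the restrictions of $C_A$, $k_A$, $(\mu_i)_i$ to $\mathcal V_{\rm NN}$, let $H_i$ be the $i$-th row of $H$, and let $\mathcal N_i(s)$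 be the set of neighbours of $i$ (including $i$) within $\mathcal V_{\rm NN}$ at time $s$. (DALE) For $b=\mu$ and for $b=\kappa$, each agent $i\in\mathcal V_{\rm NN}$ iterates, from an arbitrary vector $q_i^{(0)}\in\mathbb R^{\mathcal V_{\rm NN}}$, $$q_i^{(s+1)}=H_i^\top(H_iH_i^\top)^{-1}b_i+\frac1{|\mathcal N_i(s)|}\bigl(I-H_i^\top(H_iH_i^\top)^{-1}H_i\bigr)\sum_{j\in\mathcal N_i(s)}q_j^{(s)} .$$ If, for both right-hand sides, all these sequences converge to a limit ($q_\mu$ for $b=\mu$, $q_{\sigma^2}$ for $b=\kappa$) common to all the selected agents and all initializations, then the output is $\mu_{\rm NN}(x_*)=\kappa^\top q_\mu$ and $\sigma^2_{\rm NN}(x_*)=k(x_*,x_*)-\kappa^\top q_{\sigma^2}$. *Claim.* For every $x_*\in\mathbb R^D$: for all sufficiently large $N$ and every outcome of the data, $\mathcal V_{\rm NN}$ is nonempty and, for any initialization, both DALE runs converge as above, so that the output is well defined and the same at every selected agent; and, as $N\to\infty$, $$\mathbb E\bigl[(\mu_{\rm full}(x_*)-\mu_{\rm NN}(x_*))^2\bigr]\to0,\qquad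 \sigma^2_{\rm full}(x_*)-\sigma^2_{\rm NN}(x_*)\to0 .$$ -/

import Mathlib

open MeasureTheory ProbabilityTheory Filter Topology Matrix
open scoped NNReal ENNReal

noncomputable section

/-! ### Gaussian process regression with the separable squared exponential kernel -/

/-- Hyperparameters `(l_1, …, l_D, σ_f, σ_ε)`, all positive. -/
structure Hyperparameters (D : ℕ) where
  ell : Fin D → ℝ
  sigmaF : ℝ
  sigmaE : ℝ
  ell_pos : ∀ d, 0 < ell d
  sigmaF_pos : 0 < sigmaF
  sigmaE_pos : 0 < sigmaE

/-- The covariance function `k(x, x') = σ_f² exp (-∑_d (x_d - x'_d)² / l_d²)`. -/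
def seKernel {D : ℕ} (θ : Hyperparameters D) (x x' : EuclideanSpace ℝ (Fin D)) : ℝ :=
  θ.sigmaF ^ 2 * Real.exp (-∑ d, (x d - x' d) ^ 2 / θ.ell d ^ 2)

/-- The vector `k(X, x_*)` for a finite family of inputs `X`. -/
def kVec {D : ℕ} (θ : Hyperparameters D) {ι : Type*} (X : ι → EuclideanSpace ℝ (Fin D))
    (x : EuclideanSpace ℝ (Fin D)) : ι → ℝ :=
  fun a => seKernel θ (X a) x

/-- The covariance matrix `C_θ = k(X, X) + σ_ε² I` of the observations taken at the inputs `X`. -/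
def covMat {D : ℕ} (θ : Hyperparameters D) {ι : Type*} [DecidableEq ι]
    (X : ι → EuclideanSpace ℝ (Fin D)) : Matrix ι ι ℝ :=
  Matrix.of (fun a b => seKernel θ (X a) (X b)) + θ.sigmaE ^ 2 • (1 : Matrix ι ι ℝ)

/-- Predictive mean `k_*ᵀ C_θ⁻¹ y`. -/
def gpMean {D : ℕ} (θ : Hyperparameters D) {ι : Type*} [Fintype ι] [DecidableEq ι]
    (X : ι → EuclideanSpace ℝ (Fin D)) (y : ι → ℝ) (x : EuclideanSpace ℝ (Fin D)) : ℝ :=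
  kVec θ X x ⬝ᵥ ((covMat θ X)⁻¹ *ᵥ y)

/-- Predictive variance `k_** - k_*ᵀ C_θ⁻¹ k_*`. -/
def gpVar {D : ℕ} (θ : Hyperparameters D) {ι : Type*} [Fintype ι] [DecidableEq ι]
    (X : ι → EuclideanSpace ℝ (Fin D)) (x : EuclideanSpace ℝ (Fin D)) : ℝ :=
  seKernel θ x x - kVec θ X x ⬝ᵥ ((covMat θ X)⁻¹ *ᵥ kVec θ X x)

/-! ### The network

There are `M` agents and each of them holds `n` observations, so that `N = M * n`; the
observation with index `(i, a)` is the `a`-th observation of agent `i`. -/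

/-- The restriction of a family indexed by all observations to the local data of agent `i`. -/
def localData {M n : ℕ} {α : Type*} (z : Fin M × Fin n → α) (i : Fin M) : Fin n → α :=
  fun a => z (i, a)

/-- The time-varying undirected graph is repeatedly (jointly) connected: for some window length
`γ ≥ 1`, for every `t` the union of the graphs at the times `tγ, …, (t+1)γ - 1` is connected. -/
def RepeatedlyConnected {V : Type*} (G : ℕ → SimpleGraph V) : Prop :=
  ∃ γ : ℕ, 0 < γ ∧ ∀ t : ℕ, (⨆ s ∈ Set.Ico (t * γ) ((t + 1) * γ), G s).Connected

/-! ### NPAE quantities -/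

/-- The cross-covariance `Cov(μ_i(x_*), f(x_*)) = k_{i,*}ᵀ C_{θ,i}⁻¹ k_{i,*}` of agent `i`. -/
def npaeVec {D : ℕ} (θ : Hyperparameters D) {M n : ℕ}
    (X : Fin M × Fin n → EuclideanSpace ℝ (Fin D)) (x : EuclideanSpace ℝ (Fin D))
    (i : Fin M) : ℝ :=
  kVec θ (localData X i) x ⬝ᵥ ((covMat θ (localData X i))⁻¹ *ᵥ kVec θ (localData X i) x)

/-- The covariance block `C_{θ,ij} = Cov(y_i, y_j)`, a block of the covariance matrix of all the
observations: it is `k(X_i, X_j)` for `i ≠ j` and `k(X_i, X_i) + σ_ε² I` for `i = j`. -/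
def crossBlock {D : ℕ} (θ : Hyperparameters D) {M n : ℕ}
    (X : Fin M × Fin n → EuclideanSpace ℝ (Fin D)) (i j : Fin M) : Matrix (Fin n) (Fin n) ℝ :=
  (covMat θ X).submatrix (fun a => (i, a)) (fun b => (j, b))

/-- The matrix `C_{θ,A}` with entries
`Cov(μ_i(x_*), μ_j(x_*)) = k_{i,*}ᵀ C_{θ,i}⁻¹ C_{θ,ij} C_{θ,j}⁻¹ k_{j,*}`. -/
def npaeMat {D : ℕ} (θ : Hyperparameters D) {M n : ℕ}
    (X : Fin M × Fin n → EuclideanSpace ℝ (Fin D)) (x : EuclideanSpace ℝ (Fin D)) :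
    Matrix (Fin M) (Fin M) ℝ :=
  Matrix.of fun i j =>
    kVec θ (localData X i) x ⬝ᵥ ((covMat θ (localData X i))⁻¹ *ᵥ (crossBlock θ X i j *ᵥ
      ((covMat θ (localData X j))⁻¹ *ᵥ kVec θ (localData X j) x)))

/-- Covariance-based nearest neighbours: agent `i` is dropped when its cross-covariance
`[k_{μ,*}]_i = k_{i,*}ᵀ C_{θ,i}⁻¹ k_{i,*}` is below the threshold `η`. -/
def cbnn {D : ℕ} (θ : Hyperparameters D) (η : ℝ) {M n : ℕ}
    (X : Fin M × Fin n → EuclideanSpace ℝ (Fin D)) (x : EuclideanSpace ℝ (Fin D)) :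
    Finset (Fin M) :=
  {i | η ≤ npaeVec θ X x i}

/-! ### DALE -/

/-- Neighbours at time `t`, within the set `S` of selected agents. Every agent also is a
neighbour of itself. -/
def nbhd {V : Type*} (G : ℕ → SimpleGraph V) (S : Finset V) (t : ℕ) (i : S) : Finset S :=
  open Classical in {j | j = i ∨ (G t).Adj i j}

/-- The projection `P_i = I - H_iᵀ (H_i H_iᵀ)⁻¹ H_i` onto the kernel of the row `H_i`. -/
def daleProj {ι : Type*} [Fintype ι] [DecidableEq ι] (H : Matrix ι ι ℝ) (i : ι) :
    Matrix ι ι ℝ :=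
  1 - (H i ⬝ᵥ H i)⁻¹ • Matrix.vecMulVec (H i) (H i)

/-- One DALE update of all the agents; `q i` is the vector held by agent `i`:
`q_i ↦ H_iᵀ (H_i H_iᵀ)⁻¹ b_i + (1 / card N_i) P_i ∑_{j ∈ N_i} q_j`. -/
def daleStep {ι : Type*} [Fintype ι] [DecidableEq ι] (H : Matrix ι ι ℝ) (b : ι → ℝ)
    (nbr : ι → Finset ι) (q : ι → ι → ℝ) : ι → ι → ℝ :=
  fun i => ((H i ⬝ᵥ H i)⁻¹ * b i) • H i
    + (1 / ((nbr i).card : ℝ)) • (daleProj H i *ᵥ ∑ j ∈ nbr i, q j)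

/-- The DALE iterates from the initialization `q₀`, with neighbour sets `nbr s` at time `s`. -/
def dale {ι : Type*} [Fintype ι] [DecidableEq ι] (H : Matrix ι ι ℝ) (b : ι → ℝ)
    (nbr : ℕ → ι → Finset ι) (q₀ : ι → ι → ℝ) : ℕ → ι → ι → ℝ
  | 0 => q₀
  | s + 1 => daleStep H b (nbr s) (dale H b nbr q₀ s)

/-! ### DEC-NN-NPAE and consistency -/

/-- `m` and `v` are the prediction mean and variance produced at `x` by DEC-NN-NPAE from the
inputs `X` and the outputs `y`, whatever the initialization of DALE: CBNN selects a nonempty set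
of agents; the two DALE runs among the selected agents, for the systems `H q = μ` and
`H q = k_A`, converge, for every initialization and at every selected agent, to vectors `qμ` and
`qσ`; and `m = k_Aᵀ qμ`, `v = k_** - k_Aᵀ qσ`. -/
def IsDecNNNPAEOutput {D : ℕ} (θ : Hyperparameters D) (η : ℝ) {M n : ℕ}
    (G : ℕ → SimpleGraph (Fin M)) (X : Fin M × Fin n → EuclideanSpace ℝ (Fin D))
    (y : Fin M × Fin n → ℝ) (x : EuclideanSpace ℝ (Fin D)) (m v : ℝ) : Prop :=
  let S : Finset (Fin M) := cbnn θ η X x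
  let H : Matrix S S ℝ := (npaeMat θ X x).submatrix Subtype.val Subtype.val
  let kA : S → ℝ := fun i => npaeVec θ X x i
  let μ : S → ℝ := fun i => gpMean θ (localData X i) (localData y i) x
  S.Nonempty ∧ ∃ qμ qσ : S → ℝ,
    (∀ (q₀ : S → S → ℝ) (i : S),
      Tendsto (fun s => dale H μ (nbhd G S) q₀ s i) atTop (𝓝 qμ)) ∧
    (∀ (q₀ : S → S → ℝ) (i : S),
      Tendsto (fun s => dale H kA (nbhd G S) q₀ s i) atTop (𝓝 qσ)) ∧
    m = kA ⬝ᵥ qμ ∧ v = seKernel θ x x - kA ⬝ᵥ qσ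

/-- Consistency: as the number of observations tends to infinity, at every location `x` the
difference of the full and the aggregated mean tends to zero in mean square, and so does the
difference of the two variances (which are not random). -/
def IsConsistent {Ω E : Type*} [MeasurableSpace Ω] (P : Measure Ω)
    (meanFull meanAgg : ℕ → E → Ω → ℝ) (varFull varAgg : ℕ → E → ℝ) : Prop :=
  ∀ x : E,
    Tendsto (fun n => eLpNorm (fun ω => meanFull n x ω - meanAgg n x ω) 2 P) atTop (𝓝 0) ∧
    Tendsto (fun n => varFull n x - varAgg n x) atTop (𝓝 0)

/-- The design points become dense in some nonempty open region. -/
def FillsRegion {E : Type*} [PseudoMetricSpace E] (X : (n : ℕ) → Fin n → E) : Prop :=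
  ∃ U : Set E, IsOpen U ∧ U.Nonempty ∧
    ∀ x ∈ U, ∀ r > 0, ∀ᶠ n in atTop, ∃ a : Fin n, dist (X n a) x < r

/-- The observation model `y = f(X) + ε` at the inputs `X n`, `n = 0, 1, 2, …`: `f` is a centred
Gaussian process with the squared exponential covariance and, for every `n`, the noise variables
are i.i.d. `N(0, σ_ε²)` and independent of `f`. -/
structure ObservationModel {Ω : Type*} [MeasurableSpace Ω] (P : Measure Ω) {D : ℕ}
    (θ : Hyperparameters D) {M : ℕ}
    (X : (n : ℕ) → Fin M × Fin n → EuclideanSpace ℝ (Fin D))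
    (f : EuclideanSpace ℝ (Fin D) → Ω → ℝ) (ε y : (n : ℕ) → Fin M × Fin n → Ω → ℝ) : Prop where
  gaussian : IsGaussianProcess f P
  centred : ∀ x, ∫ ω, f x ω ∂P = 0
  covariance : ∀ x x', cov[f x, f x'; P] = seKernel θ x x'
  noise_law : ∀ n p, HasLaw (ε n p) (gaussianReal 0 (θ.sigmaE ^ 2).toNNReal) P
  noise_indep : ∀ n, iIndepFun (ε n) P
  noise_indep_signal : ∀ n, IndepFun (fun ω x => f x ω) (fun ω p => ε n p ω) P
  obs : ∀ n p ω, y n p ω = f (X n p) ω + ε n p ω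

end

/-! The proof rests on one fact: each agent's own posterior variance tends to zero
(`tendsto_gpVar_of_fillsRegion`). On a line the squared exponential kernel has a feature map that
is, up to a positive factor, a power series, so the features of points near any centre have closed
span containing all the features; hence noise-free values in an open set predict the value anywhere.
Spreading the weights over many nearby observations averages the noise away.

Since `[k_A]_i` is `σ_f²` minus the local posterior variance and `η < σ_f²`, all agents are
eventually selected. The selected network is then the whole, repeatedly connected one, and `H = C_A`
is positive definite. The DALE errors follow averaged orthogonal projections without a common
nonzero fixed vector, and these contract geometrically (`tendsto_avgProjIter`). So DALE solves `H q
= b`, and the output is the best linear combination of the local predictors.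

The error of that combination lies between the full posterior variance and the posterior variance of
any single agent, which settles the variances. By Pythagoras the mean square difference of the two
means equals the difference of the two errors, so it tends to zero too. -/

/-! ### Averaged projections over a time-varying network -/

section AveragedProjections

variable {ι E : Type*} [NormedAddCommGroup E] [InnerProductSpace ℝ E]

/-- One step of averaged projections: agent `i` averages over its neighbours, then applies `P i`. -/
noncomputable def avgProjStep (P : ι → E →L[ℝ] E) (N : ι → Finset ι) : (ι → E) →L[ℝ] (ι → E) :=
  ContinuousLinearMap.pi fun i =>
    (1 / ((N i).card : ℝ)) • (P i).comp (∑ j ∈ N i, ContinuousLinearMap.proj j)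

/-- The first `t` steps of averaged projections over the neighbour sets `N 0, N 1, …`. -/
noncomputable def avgProjIter (P : ι → E →L[ℝ] E) (N : ℕ → ι → Finset ι) :
    ℕ → (ι → E) →L[ℝ] (ι → E)
  | 0 => ContinuousLinearMap.id ℝ _
  | t + 1 => (avgProjStep P (N t)).comp (avgProjIter P N t)

lemma avgProjStep_apply (P : ι → E →L[ℝ] E) (N : ι → Finset ι) (e : ι → E) (i : ι) :
    avgProjStep P N e i = (1 / ((N i).card : ℝ)) • P i (∑ j ∈ N i, e j) := by
  simp [avgProjStep]

lemma avgProjIter_add (P : ι → E →L[ℝ] E) (N : ℕ → ι → Finset ι) (s t : ℕ) :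
    avgProjIter P N (s + t) =
      (avgProjIter P (fun r => N (s + r)) t).comp (avgProjIter P N s) := by
  induction t with
  | zero => rfl
  | succ t ih => rw [← add_assoc, avgProjIter, ih]; rfl

lemma norm_average_le {s : Finset ι} {e : ι → E} {r : ℝ} (hr : 0 ≤ r) (he : ∀ j ∈ s, ‖e j‖ ≤ r) :
    ‖(1 / (s.card : ℝ)) • ∑ j ∈ s, e j‖ ≤ r := by
  rw [norm_smul, Real.norm_of_nonneg (by positivity)]
  rcases s.eq_empty_or_nonempty with rfl | hs
  · simpa using hr
  have hc : (0 : ℝ) < s.card := by exact_mod_cast hs.card_pos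
  rw [one_div, inv_mul_le_iff₀ hc]
  calc ‖∑ j ∈ s, e j‖ ≤ ∑ j ∈ s, ‖e j‖ := norm_sum_le _ _
    _ ≤ s.card • r := Finset.sum_le_card_nsmul _ _ _ he
    _ = s.card * r := by simp

/-- Strict convexity of the ball: the inner products of the average with the `e j` are at most `r ^
2` and average to `r ^ 2`, so all are equalities. -/
lemma eq_average_of_le_norm_average {s : Finset ι} (hs : s.Nonempty) {e : ι → E} {r : ℝ}
    (hr : 0 ≤ r) (he : ∀ j ∈ s, ‖e j‖ ≤ r)
    (h : r ≤ ‖(1 / (s.card : ℝ)) • ∑ j ∈ s, e j‖) :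
    ∀ j ∈ s, e j = (1 / (s.card : ℝ)) • ∑ j ∈ s, e j := by
  set a := (1 / (s.card : ℝ)) • ∑ j ∈ s, e j with ha
  have hc : (0 : ℝ) < s.card := by exact_mod_cast hs.card_pos
  have har : ‖a‖ = r := le_antisymm (norm_average_le hr he) h
  have hle : ∀ j ∈ s, inner ℝ a (e j) ≤ r ^ 2 := fun j hj =>
    (real_inner_le_norm _ _).trans (by rw [har, sq]; exact mul_le_mul_of_nonneg_left (he j hj) hr)
  have hsum : ∑ j ∈ s, inner ℝ a (e j) = ∑ _j ∈ s, r ^ 2 := by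
    have h1 : (s.card : ℝ) • a = ∑ j ∈ s, e j := by
      rw [ha, smul_smul, mul_one_div_cancel hc.ne', one_smul]
    rw [← inner_sum, ← h1, inner_smul_right, real_inner_self_eq_norm_sq, har]
    simp
  have heq := (Finset.sum_eq_sum_iff_of_le hle).1 hsum
  intro j hj
  have h2 : ‖e j - a‖ ^ 2 ≤ 0 := by
    rw [norm_sub_sq_real, real_inner_comm, heq j hj, har]
    nlinarith [pow_le_pow_left₀ (norm_nonneg _) (he j hj) 2]
  exact sub_eq_zero.1 (norm_eq_zero.1 (pow_eq_zero_iff two_ne_zero |>.1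
    (le_antisymm h2 (sq_nonneg _))))

variable [Fintype ι]

lemma norm_avgProjStep_le {P : ι → E →L[ℝ] E} (hP : ∀ i v, ‖P i v‖ ≤ ‖v‖) (N : ι → Finset ι)
    (e : ι → E) : ‖avgProjStep P N e‖ ≤ ‖e‖ := by
  refine (pi_norm_le_iff_of_nonneg (norm_nonneg _)).2 fun i => ?_
  rw [avgProjStep_apply, ← map_smul]
  exact (hP _ _).trans (norm_average_le (norm_nonneg _) fun j _ => norm_le_pi_norm e j)

lemma norm_avgProjIter_le {P : ι → E →L[ℝ] E} (hP : ∀ i v, ‖P i v‖ ≤ ‖v‖)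
    (N : ℕ → ι → Finset ι) (e : ι → E) (t : ℕ) : ‖avgProjIter P N t e‖ ≤ ‖e‖ := by
  induction t with
  | zero => rfl
  | succ t ih => exact (norm_avgProjStep_le hP _ _).trans ih

/-- If a step attains the maximal norm at agent `i`, then all the neighbours of `i` hold the same
vector, and it is fixed by `P i`. -/
lemma avgProjStep_eq_of_le_norm {P : ι → E →L[ℝ] E}
    (hP' : ∀ i v, ‖v‖ ≤ ‖P i v‖ → P i v = v) {N : ι → Finset ι} {i : ι} (hi : i ∈ N i)
    {e : ι → E} {r : ℝ} (hr : ‖e‖ ≤ r) (h : r ≤ ‖avgProjStep P N e i‖) :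
    P i (avgProjStep P N e i) = avgProjStep P N e i ∧ ∀ j ∈ N i, e j = avgProjStep P N e i := by
  have hr0 : 0 ≤ r := (norm_nonneg _).trans hr
  have he : ∀ j ∈ N i, ‖e j‖ ≤ r := fun j _ => (norm_le_pi_norm e j).trans hr
  rw [avgProjStep_apply, ← map_smul] at h ⊢
  have h1 := norm_average_le hr0 he
  have h2 := hP' i _ (h1.trans h)
  rw [h2] at h ⊢
  exact ⟨h2, eq_average_of_le_norm_average ⟨i, hi⟩ hr0 he h⟩

/-- Over `card ι + 1` connected blocks of length `γ`, averaged projections with no common fixed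
vector strictly decrease the norm. -/
lemma norm_avgProjIter_lt {P : ι → E →L[ℝ] E} (hP : ∀ i v, ‖P i v‖ ≤ ‖v‖)
    (hP' : ∀ i v, ‖v‖ ≤ ‖P i v‖ → P i v = v) (hfix : ∀ v, (∀ i, P i v = v) → v = 0)
    {N : ℕ → ι → Finset ι} (hN : ∀ s i, i ∈ N s i) {γ : ℕ} (hγ : 0 < γ)
    (hconn : ∀ t, ∀ A : Set ι, A.Nonempty →
      (∀ s ∈ Set.Ico (t * γ) ((t + 1) * γ), ∀ j ∈ A, ∀ k ∈ N s j, k ∈ A) → A = Set.univ)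
    {e : ι → E} (he : e ≠ 0) :
    ‖avgProjIter P N ((Fintype.card ι + 1) * γ) e‖ < ‖e‖ := by
  by_contra! hcon
  have hr : 0 < ‖e‖ := norm_pos_iff.2 he
  obtain ⟨i, hi⟩ : ∃ i, ‖e‖ ≤ ‖avgProjIter P N ((Fintype.card ι + 1) * γ) e i‖ := by
    by_contra! h
    exact absurd ((pi_norm_lt_iff hr).2 h) (not_lt.2 hcon)
  set v := avgProjIter P N ((Fintype.card ι + 1) * γ) e i with hv
  -- The agents holding the extremal vector `v`, followed backwards in time: equality in every step
  -- forces the neighbours to have held `v` one step earlier.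
  let A : ℕ → Set ι := fun s => {j | avgProjIter P N s e j = v}
  have hstep : ∀ s, ∀ j ∈ A (s + 1), P j v = v ∧ ∀ k ∈ N s j, k ∈ A s := by
    intro s j hj
    have hj' : avgProjStep P (N s) (avgProjIter P N s e) j = v := hj
    have := avgProjStep_eq_of_le_norm hP' (hN s j) (norm_avgProjIter_le hP N e s)
      (by rw [hj']; exact hi)
    rwa [hj'] at this
  have hanti : Antitone A := antitone_nat_of_succ_le fun s j hj => (hstep s j hj).2 j (hN s j)
  -- If `A` did not change over a block it would be closed under all neighbours of that block, hence
  -- everything by connectivity.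
  have hgrow : ∀ t, (A ((t + 1) * γ)).Nonempty → A ((t + 1) * γ) ≠ Set.univ →
      (A ((t + 1) * γ)).ncard < (A (t * γ)).ncard := by
    intro t hne hun
    refine Set.ncard_lt_ncard ((hanti (Nat.mul_le_mul_right _ t.le_succ)).lt_of_ne fun heq => ?_)
      (Set.toFinite _)
    refine hun (hconn t _ hne fun s hs j hj k hk => ?_)
    have h1 : j ∈ A (s + 1) := hanti (Nat.succ_le_of_lt hs.2) hj
    have h2 : k ∈ A (t * γ) := hanti hs.1 ((hstep s j h1).2 k hk)
    rwa [← heq] at h2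
  have hcard : ∀ m ≤ Fintype.card ι, (A ((Fintype.card ι + 1 - m) * γ)).Nonempty ∧
      (A ((Fintype.card ι + 1 - m) * γ) = Set.univ ∨
        m < (A ((Fintype.card ι + 1 - m) * γ)).ncard) := by
    intro m
    induction m with
    | zero =>
      intro _
      have : i ∈ A ((Fintype.card ι + 1 - 0) * γ) := hv.symm
      exact ⟨⟨i, this⟩, Or.inr ((Set.ncard_pos (Set.toFinite _)).2 ⟨i, this⟩)⟩
    | succ m ih =>
      intro hm
      obtain ⟨hne, hor⟩ := ih (by omega)
      obtain ⟨t, ht⟩ : ∃ t, Fintype.card ι + 1 - m = t + 1 := ⟨Fintype.card ι - m, by omega⟩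
      have ht' : Fintype.card ι + 1 - (m + 1) = t := by omega
      rw [ht] at hne hor
      rw [ht']
      have hsub := hanti (Nat.mul_le_mul_right γ t.le_succ)
      refine ⟨hne.mono hsub, ?_⟩
      by_cases hun : A ((t + 1) * γ) = Set.univ
      · exact Or.inl (Set.univ_subset_iff.1 (hun ▸ hsub))
      · have := hgrow t hne hun
        rcases hor with h | h
        · exact absurd h hun
        · exact Or.inr (by omega)
  have hall : A (1 * γ) = Set.univ := by
    have := (hcard (Fintype.card ι) le_rfl).2
    rw [Nat.add_sub_cancel_left] at this
    refine this.resolve_right fun h => ?_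
    have := Set.ncard_le_card (A (1 * γ))
    rw [Nat.card_eq_fintype_card] at this
    omega
  -- The spare block pays off here: all agents hold `v` at the positive time `γ`, so each has just
  -- applied its own projection and fixes `v`.
  obtain ⟨s, rfl⟩ : ∃ s, γ = s + 1 := ⟨γ - 1, by omega⟩
  have hv0 : v = 0 := hfix v fun j => by
    have hj : j ∈ A (1 * (s + 1)) := hall ▸ Set.mem_univ j
    rw [one_mul] at hj
    exact (hstep s j hj).1
  rw [hv0, norm_zero] at hi
  exact absurd hi (not_le.2 hr)

/-- By compactness the operator norm is attained on the unit sphere; the sphere is empty when the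
space is trivial. -/
lemma ContinuousLinearMap.norm_lt_one_of_norm_apply_lt {F : Type*} [NormedAddCommGroup F]
    [NormedSpace ℝ F] [FiniteDimensional ℝ F] (L : F →L[ℝ] F) (hL : ∀ v ≠ 0, ‖L v‖ < ‖v‖) :
    ‖L‖ < 1 := by
  have := FiniteDimensional.proper_real F
  rcases (Metric.sphere (0 : F) 1).eq_empty_or_nonempty with h | h
  · refine lt_of_le_of_lt (L.opNorm_le_of_unit_norm (C := 0) le_rfl fun x hx => ?_) zero_lt_one
    have : x ∈ Metric.sphere (0 : F) 1 := by simpa using hx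
    simp [h] at this
  · obtain ⟨x, hx, hmax⟩ := (isCompact_sphere (0 : F) 1).exists_isMaxOn h
      (f := fun x => ‖L x‖) (by fun_prop)
    have hx1 : ‖x‖ = 1 := by simpa using hx
    have hx0 : x ≠ 0 := by rintro rfl; simp at hx1
    refine lt_of_le_of_lt (L.opNorm_le_of_unit_norm (norm_nonneg (L x)) fun y hy => ?_)
      (hx1 ▸ hL x hx0)
    exact hmax (by simpa using hy)

/-- Finitely many agents allow finitely many neighbour assignments per step. This makes the
contraction factor uniform over all time windows. -/
lemma finite_range_avgProjIter (P : ι → E →L[ℝ] E) (t : ℕ) :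
    (Set.range fun N : ℕ → ι → Finset ι => avgProjIter P N t).Finite := by
  classical
  induction t with
  | zero => exact (Set.finite_singleton (ContinuousLinearMap.id ℝ (ι → E))).subset (by
      rintro _ ⟨N, rfl⟩; rfl)
  | succ t ih =>
    refine (Set.Finite.image2 (fun a b => ContinuousLinearMap.comp a b)
      (Set.finite_range (avgProjStep P)) ih).subset ?_
    rintro _ ⟨N, rfl⟩
    exact ⟨_, ⟨N t, rfl⟩, _, ⟨N, rfl⟩, rfl⟩

/-- Averaged projections without a common nonzero fixed vector converge to zero over a repeatedly
connected network. -/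
theorem tendsto_avgProjIter [FiniteDimensional ℝ E] {P : ι → E →L[ℝ] E}
    (hP : ∀ i v, ‖P i v‖ ≤ ‖v‖)
    (hP' : ∀ i v, ‖v‖ ≤ ‖P i v‖ → P i v = v) (hfix : ∀ v, (∀ i, P i v = v) → v = 0)
    {N : ℕ → ι → Finset ι} (hN : ∀ s i, i ∈ N s i) {γ : ℕ} (hγ : 0 < γ)
    (hconn : ∀ t, ∀ A : Set ι, A.Nonempty →
      (∀ s ∈ Set.Ico (t * γ) ((t + 1) * γ), ∀ j ∈ A, ∀ k ∈ N s j, k ∈ A) → A = Set.univ)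
    (e : ι → E) : Tendsto (fun s => avgProjIter P N s e) atTop (𝓝 0) := by
  set T := (Fintype.card ι + 1) * γ with hT
  have hTpos : 0 < T := by positivity
  -- `ρ` is the largest norm below 1 among all `T`-step operators; inserting 0 keeps the set
  -- nonempty.
  have hfin : (insert (0 : ℝ) ((norm '' Set.range fun N : ℕ → ι → Finset ι => avgProjIter P N T)
      ∩ Set.Iio 1)).Finite :=
    (((finite_range_avgProjIter P T).image _).subset Set.inter_subset_left).insert 0
  obtain ⟨ρ, hρ, hmax⟩ := Set.exists_max_image _ id hfin ⟨0, Set.mem_insert _ _⟩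
  have hρ0 : 0 ≤ ρ := hmax 0 (Set.mem_insert _ _)
  have hρ1 : ρ < 1 := by
    rcases hρ with rfl | h
    · exact zero_lt_one
    · exact h.2
  have hcontr : ∀ k, ‖avgProjIter P (fun r => N (k * T + r)) T‖ ≤ ρ := by
    intro k
    refine hmax _ (Or.inr ⟨⟨_, ⟨_, rfl⟩, rfl⟩, ?_⟩)
    refine ContinuousLinearMap.norm_lt_one_of_norm_apply_lt _ fun v hv => ?_
    refine norm_avgProjIter_lt hP hP' hfix (fun s i => hN _ i) hγ (fun t A hA hcl => ?_) hv
    refine hconn (k * (Fintype.card ι + 1) + t) A hA fun s hs => ?_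
    have hkT : k * T = k * (Fintype.card ι + 1) * γ := by rw [hT, mul_assoc]
    have h1 : k * T + t * γ ≤ s := by rw [hkT, ← add_mul]; exact hs.1
    have h2 : s < k * T + (t + 1) * γ := by rw [hkT, ← add_mul, ← add_assoc]; exact hs.2
    have := hcl (s - k * T) ⟨by omega, by omega⟩
    rwa [show k * T + (s - k * T) = s by omega] at this
  have hgeom : ∀ k, ‖avgProjIter P N (k * T) e‖ ≤ ρ ^ k * ‖e‖ := by
    intro k
    induction k with
    | zero => simp [avgProjIter]
    | succ k ih =>
      rw [add_mul, one_mul, avgProjIter_add]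
      calc _ ≤ ‖avgProjIter P (fun r => N (k * T + r)) T‖ * ‖avgProjIter P N (k * T) e‖ :=
            ContinuousLinearMap.le_opNorm _ _
        _ ≤ ρ * (ρ ^ k * ‖e‖) := mul_le_mul (hcontr k) ih (norm_nonneg _) hρ0
        _ = ρ ^ (k + 1) * ‖e‖ := by ring
  -- The `s % T` steps after the last full window do not increase the norm.
  refine squeeze_zero_norm (a := fun s => ρ ^ (s / T) * ‖e‖) (fun s => ?_) ?_
  · conv_lhs => rw [← Nat.div_add_mod' s T, avgProjIter_add]
    exact (norm_avgProjIter_le hP _ _ _).trans (hgeom _)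
  · rw [← zero_mul ‖e‖]
    exact ((tendsto_pow_atTop_nhds_zero_of_lt_one hρ0 hρ1).comp
      (Nat.tendsto_div_const_atTop hTpos.ne')).mul_const _

end AveragedProjections

/-! ### Convergence of DALE -/

lemma EuclideanSpace.norm_sq_eq_dotProduct {ι : Type*} [Fintype ι] (v : EuclideanSpace ℝ ι) :
    ‖v‖ ^ 2 = v.ofLp ⬝ᵥ v.ofLp := by
  rw [EuclideanSpace.real_norm_sq_eq]
  simp [dotProduct, sq]

section Dale

variable {ι : Type*} [Fintype ι] [DecidableEq ι]

lemma daleProj_mulVec (H : Matrix ι ι ℝ) (i : ι) (v : ι → ℝ) :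
    daleProj H i *ᵥ v = v - ((H i ⬝ᵥ H i)⁻¹ * (H i ⬝ᵥ v)) • H i := by
  rw [daleProj, sub_mulVec, one_mulVec, smul_mulVec, vecMulVec_mulVec, op_smul_eq_smul, smul_smul]

lemma dotProduct_daleProj_mulVec_self (H : Matrix ι ι ℝ) (i : ι) (v : ι → ℝ) :
    (daleProj H i *ᵥ v) ⬝ᵥ (daleProj H i *ᵥ v) =
      v ⬝ᵥ v - (H i ⬝ᵥ H i)⁻¹ * (H i ⬝ᵥ v) ^ 2 := by
  rw [daleProj_mulVec]
  simp only [sub_dotProduct, dotProduct_sub, smul_dotProduct, dotProduct_smul, smul_eq_mul]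
  rw [dotProduct_comm v (H i)]
  -- For a zero row the inverse is 0 and the projection is the identity.
  by_cases h : H i ⬝ᵥ H i = 0
  · simp [h]
  · field_simp
    ring

/-- The projection of DALE as an operator on Euclidean space. -/
noncomputable def daleProjCLM (H : Matrix ι ι ℝ) (i : ι) :
    EuclideanSpace ℝ ι →L[ℝ] EuclideanSpace ℝ ι :=
  Matrix.toEuclideanCLM (𝕜 := ℝ) (daleProj H i)

lemma daleProjCLM_apply (H : Matrix ι ι ℝ) (i : ι) (v : EuclideanSpace ℝ ι) :
    daleProjCLM H i v = WithLp.toLp 2 (daleProj H i *ᵥ v.ofLp) := by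
  apply WithLp.ofLp_injective
  simp [daleProjCLM]

lemma norm_sq_daleProjCLM (H : Matrix ι ι ℝ) (i : ι) (v : EuclideanSpace ℝ ι) :
    ‖daleProjCLM H i v‖ ^ 2 = ‖v‖ ^ 2 - (H i ⬝ᵥ H i)⁻¹ * (H i ⬝ᵥ v.ofLp) ^ 2 := by
  rw [EuclideanSpace.norm_sq_eq_dotProduct, EuclideanSpace.norm_sq_eq_dotProduct,
    daleProjCLM_apply, dotProduct_daleProj_mulVec_self]

lemma norm_daleProjCLM_le (H : Matrix ι ι ℝ) (i : ι) (v : EuclideanSpace ℝ ι) :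
    ‖daleProjCLM H i v‖ ≤ ‖v‖ := by
  refine (pow_le_pow_iff_left₀ (norm_nonneg _) (norm_nonneg _) two_ne_zero).1 ?_
  rw [norm_sq_daleProjCLM]
  have : 0 ≤ H i ⬝ᵥ H i := dotProduct_self_star_nonneg (H i)
  have := mul_nonneg (inv_nonneg.2 this) (sq_nonneg (H i ⬝ᵥ v.ofLp))
  linarith

lemma daleProjCLM_eq_self_of_le_norm (H : Matrix ι ι ℝ) (i : ι) (v : EuclideanSpace ℝ ι)
    (h : ‖v‖ ≤ ‖daleProjCLM H i v‖) : daleProjCLM H i v = v := by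
  have h1 := pow_le_pow_left₀ (norm_nonneg _) h 2
  rw [norm_sq_daleProjCLM] at h1
  have h0 : 0 ≤ H i ⬝ᵥ H i := dotProduct_self_star_nonneg (H i)
  have h2 := mul_nonneg (inv_nonneg.2 h0) (sq_nonneg (H i ⬝ᵥ v.ofLp))
  have h3 : (H i ⬝ᵥ H i)⁻¹ * (H i ⬝ᵥ v.ofLp) = 0 := by
    rcases mul_eq_zero.1 (le_antisymm (by linarith) h2) with h | h
    · rw [h, zero_mul]
    · rw [pow_eq_zero_iff two_ne_zero |>.1 h, mul_zero]
  rw [daleProjCLM_apply, daleProj_mulVec, h3, zero_smul, sub_zero]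

/-- A vector fixed by the `i`-th projection is orthogonal to row `i`; one fixed by all of them lies
in the kernel of `H`. -/
lemma eq_zero_of_daleProjCLM_eq_self {H : Matrix ι ι ℝ} (hH : ∀ v, H *ᵥ v = 0 → v = 0)
    {v : EuclideanSpace ℝ ι} (hv : ∀ i, daleProjCLM H i v = v) : v = 0 := by
  apply WithLp.ofLp_injective
  refine hH _ (funext fun i => ?_)
  have h := norm_sq_daleProjCLM H i v
  rw [hv i] at h
  change H i ⬝ᵥ v.ofLp = 0
  rcases mul_eq_zero.1 (by linarith : (H i ⬝ᵥ H i)⁻¹ * (H i ⬝ᵥ v.ofLp) ^ 2 = 0) with h | h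
  · rw [inv_eq_zero, dotProduct_self_eq_zero] at h
    rw [h, zero_dotProduct]
  · exact pow_eq_zero_iff two_ne_zero |>.1 h

/-- As `b i = H i ⬝ᵥ x`, the affine term of the update is `x` minus its projection, so the error
evolves linearly. -/
lemma daleStep_sub {H : Matrix ι ι ℝ} {b x : ι → ℝ} (hx : H *ᵥ x = b) {N : ι → Finset ι} {i : ι}
    (hi : i ∈ N i) (q : ι → ι → ℝ) :
    daleStep H b N q i - x =
      (1 / ((N i).card : ℝ)) • (daleProj H i *ᵥ ∑ j ∈ N i, (q j - x)) := by
  have hc : ((N i).card : ℝ) ≠ 0 := by exact_mod_cast (Finset.card_pos.2 ⟨i, hi⟩).ne'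
  have hb : b i = H i ⬝ᵥ x := by rw [← hx]; rfl
  rw [Finset.sum_sub_distrib, Finset.sum_const, mulVec_sub, smul_sub, mulVec_smul,
    ← Nat.cast_smul_eq_nsmul ℝ, smul_smul, one_div, inv_mul_cancel₀ hc, one_smul,
    daleProj_mulVec H i x, daleStep, hb, one_div]
  abel

/-- The errors are moved to Euclidean space because orthogonal projections need not be nonexpansive
for the sup norm of `ι → ℝ`. -/
lemma dale_sub {H : Matrix ι ι ℝ} {b x : ι → ℝ} (hx : H *ᵥ x = b) {N : ℕ → ι → Finset ι}
    (hN : ∀ s i, i ∈ N s i) (q : ι → ι → ℝ) (s : ℕ) (i : ι) :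
    dale H b N q s i - x =
      (avgProjIter (daleProjCLM H) N s (fun i => WithLp.toLp 2 (q i - x)) i).ofLp := by
  induction s generalizing i with
  | zero => rfl
  | succ s ih =>
    rw [dale, daleStep_sub hx (hN s i), avgProjIter, ContinuousLinearMap.comp_apply,
      avgProjStep_apply, daleProjCLM_apply]
    simp [ih]

/-- DALE converges to the solution of `H x = b` from every initialization, if `H` is injective and
the network is repeatedly connected. -/
theorem tendsto_dale {H : Matrix ι ι ℝ} (hH : ∀ v, H *ᵥ v = 0 → v = 0) {b x : ι → ℝ}
    (hx : H *ᵥ x = b) {N : ℕ → ι → Finset ι} (hN : ∀ s i, i ∈ N s i) {γ : ℕ} (hγ : 0 < γ)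
    (hconn : ∀ t, ∀ A : Set ι, A.Nonempty →
      (∀ s ∈ Set.Ico (t * γ) ((t + 1) * γ), ∀ j ∈ A, ∀ k ∈ N s j, k ∈ A) → A = Set.univ)
    (q : ι → ι → ℝ) (i : ι) : Tendsto (fun s => dale H b N q s i) atTop (𝓝 x) := by
  rw [← tendsto_sub_nhds_zero_iff]
  simp only [dale_sub hx hN]
  have h := tendsto_avgProjIter (norm_daleProjCLM_le H) (daleProjCLM_eq_self_of_le_norm H)
    (fun v => eq_zero_of_daleProjCLM_eq_self hH) hN hγ hconn fun i => WithLp.toLp 2 (q i - x)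
  exact ((PiLp.continuous_ofLp 2 _).tendsto 0).comp (tendsto_pi_nhds.1 h i)

end Dale

/-! ### Connectivity among the selected agents -/

lemma mem_nbhd_self {V : Type*} (G : ℕ → SimpleGraph V) (S : Finset V) (t : ℕ) (i : S) :
    i ∈ nbhd G S t i := by
  simp [nbhd]

/-- Follow a path of the union graph, each edge of which is present at some time in `T`. With `S`
proper, the path could leave `S`. -/
lemma eq_univ_of_nbhd_closed {V : Type*} {G : ℕ → SimpleGraph V} {S : Finset V}
    (hS : ∀ i, i ∈ S) {T : Set ℕ} (hG : (⨆ s ∈ T, G s).Connected) {A : Set S} (hA : A.Nonempty)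
    (hcl : ∀ s ∈ T, ∀ j ∈ A, ∀ k ∈ nbhd G S s j, k ∈ A) : A = Set.univ := by
  obtain ⟨i, hi⟩ := hA
  refine Set.eq_univ_of_forall fun k => ?_
  have h := (SimpleGraph.reachable_iff_reflTransGen _ _).1 (hG.preconnected i k)
  suffices ∀ m : V, Relation.ReflTransGen (⨆ s ∈ T, G s).Adj i m → (⟨m, hS m⟩ : S) ∈ A from
    this k h
  intro m hm
  induction hm with
  | refl => exact hi
  | tail _ hadj ih =>
    simp only [SimpleGraph.iSup_adj] at hadj
    obtain ⟨s, hs, hadj⟩ := hadj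
    exact hcl s hs _ ih _ (by simp [nbhd, hadj])

/-! ### The squared exponential kernel is determined by any open set -/

lemma hasSum_mul_pow_eq_zero {a : ℕ → ℝ} {δ : ℝ} (hδ : 0 < δ)
    (h : ∀ t, |t| < δ → HasSum (fun n => a n * t ^ n) 0) : a = 0 := by
  have hp : HasFPowerSeriesAt (0 : ℝ → ℝ) (FormalMultilinearSeries.ofScalars ℝ a) 0 := by
    rw [hasFPowerSeriesAt_iff]
    filter_upwards [Metric.ball_mem_nhds (0 : ℝ) hδ] with t ht
    have := h t (by simpa using ht)
    simpa [FormalMultilinearSeries.coeff_ofScalars, mul_comm] using this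
  have := hp.eq_zero
  rwa [FormalMultilinearSeries.ofScalars_series_eq_zero] at this

/-- Coordinates of the feature map of the one-dimensional kernel `exp (-c (s - t)²)`. -/
noncomputable def seCoord (c t : ℝ) (n : ℕ) : ℝ :=
  Real.exp (-c * t ^ 2) * √((2 * c) ^ n / n.factorial) * t ^ n

/-- Factor out `exp (-c s²) exp (-c t²)` and expand `exp (2 c s t)` in its power series. -/
lemma hasSum_seCoord_mul {c : ℝ} (hc : 0 ≤ c) (s t : ℝ) :
    HasSum (fun n => seCoord c s n * seCoord c t n) (Real.exp (-c * (s - t) ^ 2)) := by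
  have h := (NormedSpace.expSeries_div_hasSum_exp (2 * c * (s * t))).mul_left
    (Real.exp (-c * s ^ 2) * Real.exp (-c * t ^ 2))
  rw [← Real.exp_eq_exp_ℝ, ← Real.exp_add, ← Real.exp_add] at h
  convert! h using 1
  · ext n
    have : √((2 * c) ^ n / n.factorial) * √((2 * c) ^ n / n.factorial) =
      (2 * c) ^ n / n.factorial := Real.mul_self_sqrt (by positivity)
    calc _ = Real.exp (-c * s ^ 2) * Real.exp (-c * t ^ 2) *
          (√((2 * c) ^ n / n.factorial) * √((2 * c) ^ n / n.factorial)) * (s ^ n * t ^ n) := by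
          unfold seCoord; ring
      _ = _ := by rw [this, Real.exp_add, mul_pow (2 * c) (s * t), mul_pow s t]; ring
  · congr 1
    ring

/-- The feature map of the one-dimensional kernel `exp (-c (s - t)²)`. -/
noncomputable def seFeature {c : ℝ} (hc : 0 ≤ c) (t : ℝ) : lp (fun _ : ℕ => ℝ) 2 :=
  ⟨seCoord c t, memℓp_gen (by
    convert! (hasSum_seCoord_mul hc t t).summable using 2 with n
    simp [sq])⟩

lemma inner_seFeature {c : ℝ} (hc : 0 ≤ c) (s t : ℝ) :
    inner ℝ (seFeature hc s) (seFeature hc t) = Real.exp (-c * (s - t) ^ 2) := by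
  have h := lp.hasSum_inner (𝕜 := ℝ) (seFeature hc s) (seFeature hc t)
  refine h.unique ?_
  convert! hasSum_seCoord_mul hc s t using 2 with n
  simp [seFeature, mul_comm]

/-- Pairing with a vector `h` orthogonal to these features gives a power series vanishing near 0.
Its coefficients vanish, so `h` is orthogonal to every feature (`h` itself may be nonzero when `c =
0`). -/
lemma seFeature_mem_closure {c : ℝ} (hc : 0 ≤ c) {δ : ℝ} (hδ : 0 < δ) (x : ℝ) :
    seFeature hc x ∈ (Submodule.span ℝ (seFeature hc '' {t | |t| < δ})).topologicalClosure := by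
  rw [← Submodule.orthogonal_orthogonal_eq_closure, Submodule.mem_orthogonal]
  intro h hh
  have hcoord : (fun n => h n * √((2 * c) ^ n / n.factorial)) = 0 := by
    refine hasSum_mul_pow_eq_zero hδ fun t ht => ?_
    have h1 := lp.hasSum_inner (𝕜 := ℝ) (seFeature hc t) h
    rw [(Submodule.mem_orthogonal _ _).1 hh _ (Submodule.subset_span ⟨t, ht, rfl⟩)] at h1
    have h2 := h1.mul_left (Real.exp (-c * t ^ 2))⁻¹
    rw [mul_zero] at h2
    convert! h2 using 2 with n
    have : Real.exp (-c * t ^ 2) ≠ 0 := (Real.exp_pos _).ne'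
    simp only [seFeature, seCoord, RCLike.inner_apply, conj_trivial]
    field_simp
  have h1 := lp.hasSum_inner (𝕜 := ℝ) h (seFeature hc x)
  refine h1.unique ?_
  convert! hasSum_zero using 2 with n
  have := congrFun hcoord n
  simp only [seFeature, seCoord, RCLike.inner_apply, conj_trivial]
  calc _ = Real.exp (-c * x ^ 2) * x ^ n * (h n * √((2 * c) ^ n / n.factorial)) := by ring
    _ = 0 := by rw [this]; simp

/-- The kernel matrix `k(X, X)`. -/
noncomputable def gramMat {D : ℕ} (θ : Hyperparameters D) {ι : Type*}
    (X : ι → EuclideanSpace ℝ (Fin D)) : Matrix ι ι ℝ :=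
  Matrix.of fun a b => seKernel θ (X a) (X b)

/-- The squared error of the predictor with weights `w` of the value at `x` from noise-free
values at `X`. -/
noncomputable def kernelErr {D : ℕ} (θ : Hyperparameters D) {ι : Type*} [Fintype ι]
    (X : ι → EuclideanSpace ℝ (Fin D)) (x : EuclideanSpace ℝ (Fin D)) (w : ι → ℝ) : ℝ :=
  seKernel θ x x - 2 * (w ⬝ᵥ kVec θ X x) + w ⬝ᵥ (gramMat θ X *ᵥ w)

lemma kernelErr_eq_sum {D : ℕ} (θ : Hyperparameters D) {ι : Type*} [Fintype ι]
    (X : ι → EuclideanSpace ℝ (Fin D)) (x : EuclideanSpace ℝ (Fin D)) (w : ι → ℝ) :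
    kernelErr θ X x w = seKernel θ x x - 2 * ∑ i, w i * seKernel θ (X i) x +
      ∑ i, ∑ j, w i * w j * seKernel θ (X i) (X j) := by
  simp only [kernelErr, gramMat, kVec, dotProduct, mulVec, of_apply, Finset.mul_sum]
  congr 1
  refine Finset.sum_congr rfl fun i _ => Finset.sum_congr rfl fun j _ => ?_
  ring

/-- Reduces prediction at `x` from a neighbourhood of `u` to dimension one: `u` has parameter 0 and
`x` has parameter 1. -/
lemma seKernel_line {D : ℕ} (θ : Hyperparameters D) (u x : EuclideanSpace ℝ (Fin D)) (s t : ℝ) :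
    seKernel θ (u + s • (x - u)) (u + t • (x - u)) =
      θ.sigmaF ^ 2 * Real.exp (-(∑ d, (x d - u d) ^ 2 / θ.ell d ^ 2) * (s - t) ^ 2) := by
  rw [seKernel, neg_mul, Finset.sum_mul]
  congr 3
  refine Finset.sum_congr rfl fun d _ => ?_
  simp only [PiLp.add_apply, PiLp.smul_apply, PiLp.sub_apply, smul_eq_mul]
  ring

/-- From noise-free values in any nonempty open set, the value at every point can be predicted with
arbitrarily small error. -/
theorem exists_kernelErr_lt {D : ℕ} (θ : Hyperparameters D) {U : Set (EuclideanSpace ℝ (Fin D))}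
    (hU : IsOpen U) (hne : U.Nonempty) (x : EuclideanSpace ℝ (Fin D)) {r : ℝ} (hr : 0 < r) :
    ∃ (m : ℕ) (z : Fin m → EuclideanSpace ℝ (Fin D)) (w : Fin m → ℝ),
      (∀ j, z j ∈ U) ∧ kernelErr θ z x w < r := by
  obtain ⟨u, hu⟩ := hne
  have hc : 0 ≤ ∑ d, (x d - u d) ^ 2 / θ.ell d ^ 2 :=
    Finset.sum_nonneg fun d _ => by positivity
  have hcont : Continuous fun t : ℝ => u + t • (x - u) := by fun_prop
  obtain ⟨δ, hδ, hball⟩ := Metric.isOpen_iff.1 (hU.preimage hcont) 0 (by simpa using hu)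
  have hσ : 0 < θ.sigmaF ^ 2 := pow_pos θ.sigmaF_pos 2
  -- The prediction error is `σ_f²` times a squared distance of features, whence this radius.
  obtain ⟨p, hp, hdist⟩ := Metric.mem_closure_iff.1 (seFeature_mem_closure hc hδ 1)
    (√(r / θ.sigmaF ^ 2)) (by positivity)
  obtain ⟨m, w, g, rfl⟩ := (Submodule.mem_span_set' (R := ℝ)).1 hp
  choose t ht hgt using fun j => (g j).2
  refine ⟨m, fun j => u + t j • (x - u), w, fun j => hball (by simpa using ht j), ?_⟩
  rw [dist_eq_norm, Real.lt_sqrt (norm_nonneg _), lt_div_iff₀ hσ] at hdist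
  refine lt_of_eq_of_lt ?_ hdist
  have hx : x = u + (1 : ℝ) • (x - u) := by simp
  rw [kernelErr_eq_sum]
  rw [show seKernel θ x x = seKernel θ (u + (1 : ℝ) • (x - u)) (u + (1 : ℝ) • (x - u)) by
    rw [← hx]]
  have hx' : ∀ j, seKernel θ (u + t j • (x - u)) x =
      seKernel θ (u + t j • (x - u)) (u + (1 : ℝ) • (x - u)) := fun j => by rw [← hx]
  simp only [hx', seKernel_line, ← inner_seFeature hc, ← hgt]
  rw [norm_sub_sq_real, ← real_inner_self_eq_norm_sq, ← real_inner_self_eq_norm_sq]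
  simp only [sum_inner, inner_sum, real_inner_smul_left, real_inner_smul_right, add_mul, sub_mul,
    Finset.mul_sum, Finset.sum_mul]
  congr 1
  · congr 1
    · ring
    · exact Finset.sum_congr rfl fun j _ => by rw [real_inner_comm]; ring
  · exact Finset.sum_congr rfl fun i _ => Finset.sum_congr rfl fun j _ => by
      rw [real_inner_comm]; ring

lemma seKernel_comm {D : ℕ} (θ : Hyperparameters D) (x z : EuclideanSpace ℝ (Fin D)) :
    seKernel θ x z = seKernel θ z x := by
  simp only [seKernel, sub_sq_comm]

/-- The squared exponential kernel is positive semidefinite. -/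
theorem gramMat_posSemidef {D : ℕ} (θ : Hyperparameters D) {ι : Type*} [Fintype ι]
    (X : ι → EuclideanSpace ℝ (Fin D)) : (gramMat θ X).PosSemidef := by
  -- The kernel is a product over coordinates of Gram kernels; the Schur product theorem applies one
  -- coordinate at a time.
  have hprod : ∀ s : Finset (Fin D), (Matrix.of fun a b : ι =>
      ∏ d ∈ s, Real.exp (-(1 / θ.ell d ^ 2) * (X a d - X b d) ^ 2)).PosSemidef := by
    intro s
    induction s using Finset.cons_induction with
    | empty =>
      convert! posSemidef_vecMulVec_self_star (R := ℝ) (1 : ι → ℝ) using 1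
      ext a b
      simp [vecMulVec_apply]
    | cons d s hd ih =>
      have hg := posSemidef_gram ℝ fun a =>
        seFeature (c := 1 / θ.ell d ^ 2) (by positivity) (X a d)
      convert! hg.hadamard ih using 1
      ext a b
      simp only [of_apply, Finset.prod_cons, hadamard_apply, gram_apply, inner_seFeature]
  convert! (hprod Finset.univ).smul (sq_nonneg θ.sigmaF) using 1
  ext a b
  simp only [gramMat, seKernel, of_apply, Matrix.smul_apply, smul_eq_mul, ← Real.exp_sum]
  congr 2
  rw [← Finset.sum_neg_distrib]
  exact Finset.sum_congr rfl fun d _ => by ring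

/-! ### Linear prediction -/

lemma Matrix.PosDef.mulVec_inv_mulVec {ι : Type*} [Fintype ι] [DecidableEq ι] {A : Matrix ι ι ℝ}
    (hA : A.PosDef) (k : ι → ℝ) : A *ᵥ (A⁻¹ *ᵥ k) = k := by
  rw [mulVec_mulVec, mul_nonsing_inv A ((isUnit_iff_isUnit_det A).1 hA.isUnit), one_mulVec]

/-- Completing the square. -/
lemma Matrix.PosDef.dotProduct_mulVec_sub_two_mul {ι : Type*} [Fintype ι] [DecidableEq ι]
    {A : Matrix ι ι ℝ} (hA : A.PosDef) (k w : ι → ℝ) :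
    w ⬝ᵥ (A *ᵥ w) - 2 * (w ⬝ᵥ k) =
      (w - A⁻¹ *ᵥ k) ⬝ᵥ (A *ᵥ (w - A⁻¹ *ᵥ k)) - k ⬝ᵥ (A⁻¹ *ᵥ k) := by
  have hsymm : (A⁻¹ *ᵥ k) ⬝ᵥ (A *ᵥ w) = w ⬝ᵥ k := by
    rw [dotProduct_mulVec, ← mulVec_transpose, ← conjTranspose_eq_transpose_of_trivial,
      hA.isHermitian.eq, hA.mulVec_inv_mulVec, dotProduct_comm]
  rw [mulVec_sub, hA.mulVec_inv_mulVec, sub_dotProduct, dotProduct_sub, dotProduct_sub, hsymm,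
    dotProduct_comm (A⁻¹ *ᵥ k) k]
  ring

section Prediction

variable {D : ℕ} (θ : Hyperparameters D) {ι κ : Type*} [Fintype ι] [Fintype κ]

/-- This is the quadratic form of the kernel matrix with `x` adjoined to the inputs, at the weights
`(1, -w)`. -/
lemma kernelErr_nonneg (X : ι → EuclideanSpace ℝ (Fin D)) (x : EuclideanSpace ℝ (Fin D))
    (w : ι → ℝ) : 0 ≤ kernelErr θ X x w := by
  have h := (gramMat_posSemidef θ (fun o : Option ι => o.elim x X)).dotProduct_mulVec_nonneg
    (fun o => o.elim 1 fun i => - w i)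
  refine h.trans_eq ?_
  rw [kernelErr_eq_sum]
  simp only [dotProduct, mulVec, gramMat, of_apply, Fintype.sum_option, star_trivial,
    Option.elim_none, Option.elim_some, mul_add, Finset.sum_add_distrib, Finset.mul_sum]
  have h1 : ∀ i, 1 * (seKernel θ x (X i) * -w i) = -(w i * seKernel θ (X i) x) := fun i => by
    rw [seKernel_comm]; ring
  have h2 : ∀ i, -w i * (seKernel θ (X i) x * 1) = -(w i * seKernel θ (X i) x) := fun i => by ring
  have h3 : ∀ i j, -w i * (seKernel θ (X i) (X j) * -w j) =
      w i * w j * seKernel θ (X i) (X j) := fun i j => by ring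
  simp only [h1, h2, h3, Finset.sum_neg_distrib, ← Finset.mul_sum]
  ring

/-- The mean squared error of the predictor with weights `w` of the value at `x` from the
observations at `X`. -/
noncomputable def predErr (X : ι → EuclideanSpace ℝ (Fin D)) (x : EuclideanSpace ℝ (Fin D))
    (w : ι → ℝ) : ℝ :=
  kernelErr θ X x w + θ.sigmaE ^ 2 * (w ⬝ᵥ w)

lemma predErr_nonneg (X : ι → EuclideanSpace ℝ (Fin D)) (x : EuclideanSpace ℝ (Fin D))
    (w : ι → ℝ) : 0 ≤ predErr θ X x w :=
  add_nonneg (kernelErr_nonneg θ X x w)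
    (mul_nonneg (sq_nonneg _) (dotProduct_self_star_nonneg w))

section

variable [DecidableEq ι]

lemma covMat_posDef (X : ι → EuclideanSpace ℝ (Fin D)) : (covMat θ X).PosDef :=
  Matrix.PosDef.posSemidef_add (gramMat_posSemidef θ X)
    (Matrix.PosDef.one.smul (pow_pos θ.sigmaE_pos 2))

lemma predErr_eq (X : ι → EuclideanSpace ℝ (Fin D)) (x : EuclideanSpace ℝ (Fin D)) (w : ι → ℝ) :
    predErr θ X x w = seKernel θ x x - 2 * (w ⬝ᵥ kVec θ X x) + w ⬝ᵥ (covMat θ X *ᵥ w) := by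
  have : covMat θ X = gramMat θ X + θ.sigmaE ^ 2 • (1 : Matrix ι ι ℝ) := rfl
  rw [predErr, kernelErr, this, add_mulVec, smul_mulVec, one_mulVec, dotProduct_add,
    dotProduct_smul, smul_eq_mul]
  ring

/-- The excess error of a linear predictor over the posterior mean. -/
lemma predErr_eq_gpVar_add (X : ι → EuclideanSpace ℝ (Fin D)) (x : EuclideanSpace ℝ (Fin D))
    (w : ι → ℝ) :
    predErr θ X x w = gpVar θ X x + (w - (covMat θ X)⁻¹ *ᵥ kVec θ X x) ⬝ᵥ
      (covMat θ X *ᵥ (w - (covMat θ X)⁻¹ *ᵥ kVec θ X x)) := by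
  have := (covMat_posDef θ X).dotProduct_mulVec_sub_two_mul (kVec θ X x) w
  rw [predErr_eq, gpVar]
  linarith

lemma gpVar_eq_predErr (X : ι → EuclideanSpace ℝ (Fin D)) (x : EuclideanSpace ℝ (Fin D)) :
    gpVar θ X x = predErr θ X x ((covMat θ X)⁻¹ *ᵥ kVec θ X x) := by
  simp [predErr_eq_gpVar_add]

lemma gpVar_nonneg (X : ι → EuclideanSpace ℝ (Fin D)) (x : EuclideanSpace ℝ (Fin D)) :
    0 ≤ gpVar θ X x := by
  rw [gpVar_eq_predErr]
  exact predErr_nonneg θ X x _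

lemma gpVar_le_predErr (X : ι → EuclideanSpace ℝ (Fin D)) (x : EuclideanSpace ℝ (Fin D))
    (w : ι → ℝ) : gpVar θ X x ≤ predErr θ X x w := by
  rw [predErr_eq_gpVar_add]
  have := (covMat_posDef θ X).posSemidef.dotProduct_mulVec_nonneg
    (w - (covMat θ X)⁻¹ *ᵥ kVec θ X x)
  rw [star_trivial] at this
  linarith

end

/-- A predictor from some of the observations, as a predictor from all of them. -/
lemma exists_predErr_comp_eq {a : ι → κ} (ha : Function.Injective a)
    (X : κ → EuclideanSpace ℝ (Fin D)) (x : EuclideanSpace ℝ (Fin D)) (v : ι → ℝ) :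
    ∃ w : κ → ℝ, predErr θ X x w = predErr θ (X ∘ a) x v := by
  classical
  let w : κ → ℝ := fun p => ∑ i, if a i = p then v i else 0
  have hw : ∀ g : κ → ℝ, w ⬝ᵥ g = v ⬝ᵥ (g ∘ a) := by
    intro g
    simp only [w, dotProduct, Finset.sum_mul, ite_mul, zero_mul, Function.comp_apply]
    rw [Finset.sum_comm]
    simp
  have hwa : w ∘ a = v := by
    ext i
    simp [w, ha.eq_iff]
  have hg : (gramMat θ X *ᵥ w) ∘ a = gramMat θ (X ∘ a) *ᵥ v := by
    ext i
    simp only [Function.comp_apply, mulVec]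
    rw [dotProduct_comm, hw, dotProduct_comm]
    rfl
  refine ⟨w, ?_⟩
  rw [predErr, predErr, kernelErr, kernelErr, hw, hw, hw, hwa, hg]
  rfl

lemma gpVar_le_predErr_comp [DecidableEq κ] {a : ι → κ} (ha : Function.Injective a)
    (X : κ → EuclideanSpace ℝ (Fin D)) (x : EuclideanSpace ℝ (Fin D)) (v : ι → ℝ) :
    gpVar θ X x ≤ predErr θ (X ∘ a) x v := by
  obtain ⟨w, hw⟩ := exists_predErr_comp_eq θ ha X x v
  exact hw ▸ gpVar_le_predErr θ X x w

lemma continuous_kernelErr (x : EuclideanSpace ℝ (Fin D)) (w : ι → ℝ) :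
    Continuous fun X : ι → EuclideanSpace ℝ (Fin D) => kernelErr θ X x w := by
  simp only [kernelErr_eq_sum, seKernel]
  fun_prop

/-- Repeating every point `J` times and dividing the weights by `J` only reduces the noise. -/
lemma predErr_repeat {J : ℕ} (hJ : 0 < J) (z : ι → EuclideanSpace ℝ (Fin D))
    (x : EuclideanSpace ℝ (Fin D)) (w : ι → ℝ) :
    kernelErr θ (fun p : ι × Fin J => z p.1) x (fun p => w p.1 / J) = kernelErr θ z x w ∧
      (fun p : ι × Fin J => w p.1 / J) ⬝ᵥ (fun p => w p.1 / J) = (w ⬝ᵥ w) / J := by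
  have hJ' : (J : ℝ) ≠ 0 := by exact_mod_cast hJ.ne'
  constructor
  · simp only [kernelErr_eq_sum, Fintype.sum_prod_type, Finset.sum_const, Finset.card_univ,
      Fintype.card_fin, nsmul_eq_mul, Finset.mul_sum]
    congr 1
    · congr 1
      exact Finset.sum_congr rfl fun i _ => by field_simp
    · exact Finset.sum_congr rfl fun i _ => Finset.sum_congr rfl fun j _ => by field_simp
  · simp only [dotProduct, Fintype.sum_prod_type, Finset.sum_const, Finset.card_univ,
      Fintype.card_fin, nsmul_eq_mul, Finset.sum_div]
    exact Finset.sum_congr rfl fun i _ => by field_simp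

end Prediction

/-! ### Posterior variance when the design fills a region -/

lemma exists_injective_mem_of_infinite {ι α : Type*} [Fintype ι] {S : ι → Set α}
    (hS : ∀ i, (S i).Infinite) : ∃ c : ι → α, Function.Injective c ∧ ∀ i, c i ∈ S i := by
  classical
  choose t ht hcard using fun i => (hS i).exists_subset_card_eq (Fintype.card ι)
  obtain ⟨c, hc, hct⟩ := (Finset.all_card_le_biUnion_card_iff_exists_injective t).1 fun s => by
    rcases s.eq_empty_or_nonempty with rfl | ⟨i, hi⟩
    · simp
    · calc s.card ≤ Fintype.card ι := Finset.card_le_univ s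
        _ = (t i).card := (hcard i).symm
        _ ≤ _ := Finset.card_le_card (Finset.subset_biUnion_of_mem t hi)
  exact ⟨c, hc, fun i => ht i (hct i)⟩

/-- If the design points become dense near distinct points, distinct design points eventually lie
near them. -/
lemma eventually_exists_injective_dist_lt {ι E : Type*} [Fintype ι] [MetricSpace E]
    {X : (n : ℕ) → Fin n → E} {c : ι → E} (hc : Function.Injective c)
    (hX : ∀ i, ∀ r > 0, ∀ᶠ n in atTop, ∃ a : Fin n, dist (X n a) (c i) < r) {r : ℝ} (hr : 0 < r) :
    ∀ᶠ n in atTop, ∃ a : ι → Fin n, Function.Injective a ∧ ∀ i, dist (X n (a i)) (c i) < r := by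
  obtain ⟨V, hV, hdisj⟩ := (Set.finite_range c).t2_separation
  have hball : ∀ i, ∃ ρ > 0, Metric.ball (c i) ρ ⊆ V (c i) := fun i =>
    Metric.isOpen_iff.1 (hV (c i)).2 _ (hV (c i)).1
  choose ρ hρ hρV using hball
  have : ∀ᶠ n in atTop, ∀ i, ∃ a : Fin n, dist (X n a) (c i) < min r (ρ i) :=
    eventually_all.2 fun i => hX i _ (lt_min hr (hρ i))
  filter_upwards [this] with n hn
  choose a ha using hn
  refine ⟨a, fun i j hij => ?_, fun i => (ha i).trans_le (min_le_left _ _)⟩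
  by_contra hne
  have hd := hdisj ⟨i, rfl⟩ ⟨j, rfl⟩ (hc.ne hne)
  refine Set.disjoint_left.1 hd (hρV i ((ha i).trans_le (min_le_right _ _))) ?_
  rw [hij]
  exact hρV j ((ha j).trans_le (min_le_right _ _))

/-- The posterior variance tends to zero everywhere if the design fills some region. -/
theorem tendsto_gpVar_of_fillsRegion {D : ℕ} (hD : 0 < D) (θ : Hyperparameters D)
    {X : (n : ℕ) → Fin n → EuclideanSpace ℝ (Fin D)} (hX : FillsRegion X)
    (x : EuclideanSpace ℝ (Fin D)) : Tendsto (fun n => gpVar θ (X n) x) atTop (𝓝 0) := by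
  -- Positive dimension makes every neighbourhood infinite, as needed to pick distinct centres
  -- below.
  have : Nonempty (Fin D) := ⟨⟨0, hD⟩⟩
  obtain ⟨U, hU, hne, hfill⟩ := hX
  refine tendsto_order.2 ⟨fun r hr => Eventually.of_forall fun n =>
    hr.trans_le (gpVar_nonneg θ _ x), fun r hr => ?_⟩
  obtain ⟨m, z, w, hz, hw⟩ := exists_kernelErr_lt θ hU hne x (half_pos hr)
  -- Half of `r` is for the kernel error, half for the noise; `J` copies of each point divide the
  -- noise term by `J`.
  obtain ⟨J, hJ⟩ := exists_nat_gt (θ.sigmaE ^ 2 * (w ⬝ᵥ w) / (r / 2))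
  have hw0 : 0 ≤ w ⬝ᵥ w := dotProduct_self_star_nonneg w
  have hJ0 : (0 : ℝ) < J := lt_of_le_of_lt (by positivity) hJ
  obtain ⟨hrep, hnoise⟩ := predErr_repeat θ (by exact_mod_cast hJ0 : 0 < J) z x w
  set v : Fin m × Fin J → ℝ := fun p => w p.1 / J
  have hnoise' : θ.sigmaE ^ 2 * (v ⬝ᵥ v) < r / 2 := by
    rw [hnoise, mul_div_assoc', div_lt_iff₀ hJ0]
    rw [div_lt_iff₀ (half_pos hr)] at hJ
    linarith
  obtain ⟨δ, hδ, hball⟩ := Metric.isOpen_iff.1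
    (isOpen_Iio.preimage (continuous_kernelErr θ x v)) (fun p : Fin m × Fin J => z p.1)
    (by simpa [hrep] using hw)
  -- The `J` copies of a point are perturbed to distinct centres, so that they are matched with
  -- distinct observations.
  obtain ⟨c, hc, hcU⟩ := exists_injective_mem_of_infinite
    (S := fun p : Fin m × Fin J => U ∩ Metric.ball (z p.1) (δ / 2)) fun p =>
    infinite_of_mem_nhds (z p.1)
      (inter_mem (hU.mem_nhds (hz p.1)) (Metric.ball_mem_nhds _ (half_pos hδ)))
  filter_upwards [eventually_exists_injective_dist_lt hc (fun p => hfill _ (hcU p).1)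
    (half_pos hδ)] with n ⟨a, ha, hdist⟩
  have hmem : X n ∘ a ∈ Metric.ball (fun p : Fin m × Fin J => z p.1) δ := by
    refine (dist_pi_lt_iff hδ).2 fun p => ?_
    calc dist (X n (a p)) (z p.1) ≤ dist (X n (a p)) (c p) + dist (c p) (z p.1) :=
          dist_triangle _ _ _
      _ < δ / 2 + δ / 2 := add_lt_add (hdist p) (hcU p).2
      _ = δ := add_halves δ
  have h1 : kernelErr θ (X n ∘ a) x v < r / 2 := hball hmem
  calc gpVar θ (X n) x ≤ predErr θ (X n ∘ a) x v := gpVar_le_predErr_comp θ ha (X n) x v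
    _ < r / 2 + r / 2 := add_lt_add h1 hnoise'
    _ = r := add_halves r

/-! ### Aggregation of the local predictors -/

section Npae

variable {D : ℕ} (θ : Hyperparameters D) {M n : ℕ} (X : Fin M × Fin n → EuclideanSpace ℝ (Fin D))
  (x : EuclideanSpace ℝ (Fin D))

/-- The weights of the posterior mean, as a linear function of the observations. -/
noncomputable def gpWeights {ι : Type*} [Fintype ι] [DecidableEq ι]
    (X : ι → EuclideanSpace ℝ (Fin D)) (x : EuclideanSpace ℝ (Fin D)) : ι → ℝ :=
  (covMat θ X)⁻¹ *ᵥ kVec θ X x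

lemma gpMean_eq_gpWeights_dotProduct {ι : Type*} [Fintype ι] [DecidableEq ι]
    (X : ι → EuclideanSpace ℝ (Fin D)) (y : ι → ℝ) (x : EuclideanSpace ℝ (Fin D)) :
    gpMean θ X y x = gpWeights θ X x ⬝ᵥ y := by
  rw [gpMean, gpWeights, dotProduct_mulVec, ← mulVec_transpose,
    ← conjTranspose_eq_transpose_of_trivial, (covMat_posDef θ X).isHermitian.inv.eq]

lemma covMat_mulVec_gpWeights {ι : Type*} [Fintype ι] [DecidableEq ι]
    (X : ι → EuclideanSpace ℝ (Fin D)) (x : EuclideanSpace ℝ (Fin D)) :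
    covMat θ X *ᵥ gpWeights θ X x = kVec θ X x :=
  (covMat_posDef θ X).mulVec_inv_mulVec _

/-- Row `i` holds the weights of the predictor of agent `i`, extended by zero to all the
observations. -/
noncomputable def agentWeights : Matrix (Fin M) (Fin M × Fin n) ℝ :=
  Matrix.of fun i p => if p.1 = i then gpWeights θ (localData X i) x p.2 else 0

lemma agentWeights_dotProduct (i : Fin M) (g : Fin M × Fin n → ℝ) :
    agentWeights θ X x i ⬝ᵥ g = gpWeights θ (localData X i) x ⬝ᵥ localData g i := by
  simp only [agentWeights, dotProduct, of_apply, Fintype.sum_prod_type, ite_mul, zero_mul,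
    localData]
  rw [Finset.sum_comm]
  simp

lemma gpMean_localData (i : Fin M) (y : Fin M × Fin n → ℝ) :
    gpMean θ (localData X i) (localData y i) x = (agentWeights θ X x *ᵥ y) i := by
  rw [gpMean_eq_gpWeights_dotProduct, mulVec, agentWeights_dotProduct]

lemma npaeVec_eq : npaeVec θ X x = agentWeights θ X x *ᵥ kVec θ X x := by
  ext i
  rw [mulVec, agentWeights_dotProduct, dotProduct_comm]
  rfl

lemma localData_covMat_mulVec_agentWeights (i j : Fin M) :
    localData (covMat θ X *ᵥ agentWeights θ X x j) i =
      crossBlock θ X i j *ᵥ gpWeights θ (localData X j) x := by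
  ext a
  rw [localData, mulVec, dotProduct_comm, agentWeights_dotProduct, dotProduct_comm]
  rfl

/-- The local means are `W y` with `W` the matrix `agentWeights`, so their covariance is `W C Wᵀ`.
-/
lemma npaeMat_eq : npaeMat θ X x =
    agentWeights θ X x * covMat θ X * (agentWeights θ X x)ᵀ := by
  ext i j
  have h : (agentWeights θ X x * covMat θ X * (agentWeights θ X x)ᵀ) i j =
      agentWeights θ X x i ⬝ᵥ (covMat θ X *ᵥ agentWeights θ X x j) := by
    rw [Matrix.mul_assoc]
    rfl
  rw [h, agentWeights_dotProduct, localData_covMat_mulVec_agentWeights]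
  change kVec θ (localData X i) x ⬝ᵥ ((covMat θ (localData X i))⁻¹ *ᵥ _) = _
  exact gpMean_eq_gpWeights_dotProduct θ (localData X i) _ x

lemma npaeMat_self (i : Fin M) : npaeMat θ X x i i = npaeVec θ X x i := by
  have h : crossBlock θ X i i = covMat θ (localData X i) := by
    ext a b
    simp [crossBlock, covMat, localData, one_apply]
  have h2 := covMat_mulVec_gpWeights θ (localData X i) x
  rw [gpWeights] at h2
  rw [npaeMat, of_apply, h, h2]
  rfl

lemma gpWeights_ne_zero {ι : Type*} [Fintype ι] [DecidableEq ι] [Nonempty ι]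
    (X : ι → EuclideanSpace ℝ (Fin D)) (x : EuclideanSpace ℝ (Fin D)) : gpWeights θ X x ≠ 0 := by
  intro h
  have h2 := covMat_mulVec_gpWeights θ X x
  rw [h, mulVec_zero] at h2
  have h3 := congrFun h2 (Classical.arbitrary ι)
  have : 0 < θ.sigmaF ^ 2 := pow_pos θ.sigmaF_pos 2
  exact (mul_pos this (Real.exp_pos _)).ne h3

/-- The rows of `agentWeights` are nonzero with disjoint supports, hence independent, and the full
covariance matrix is positive definite. -/
lemma npaeMat_posDef (hn : 0 < n) : (npaeMat θ X x).PosDef := by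
  have : Nonempty (Fin n) := ⟨⟨0, hn⟩⟩
  rw [npaeMat_eq, ← conjTranspose_eq_transpose_of_trivial]
  refine (covMat_posDef θ X).mul_mul_conjTranspose_same fun u v huv => ?_
  ext i
  obtain ⟨a, ha⟩ := Function.ne_iff.1 (gpWeights_ne_zero θ (localData X i) x)
  have h := congrFun huv (i, a)
  simp only [vecMul, dotProduct, agentWeights, of_apply, mul_ite, mul_zero, Finset.sum_ite_eq,
    Finset.mem_univ, if_true] at h
  exact mul_right_cancel₀ ha h

/-- The weights of the aggregated predictor on all the observations. -/
noncomputable def npaeWeights : Fin M × Fin n → ℝ :=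
  ((npaeMat θ X x)⁻¹ *ᵥ npaeVec θ X x) ᵥ* agentWeights θ X x

/-- The aggregated mean `k_Aᵀ C_A⁻¹ μ` of all the agents. -/
noncomputable def npaeMean (y : Fin M × Fin n → ℝ) : ℝ :=
  npaeVec θ X x ⬝ᵥ ((npaeMat θ X x)⁻¹ *ᵥ
    fun i => gpMean θ (localData X i) (localData y i) x)

/-- The aggregated variance `k_** - k_Aᵀ C_A⁻¹ k_A` of all the agents. -/
noncomputable def npaeVar : ℝ :=
  seKernel θ x x - npaeVec θ X x ⬝ᵥ ((npaeMat θ X x)⁻¹ *ᵥ npaeVec θ X x)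

variable {θ X x}

lemma npaeMean_eq_npaeWeights_dotProduct (hn : 0 < n) (y : Fin M × Fin n → ℝ) :
    npaeMean θ X x y = npaeWeights θ X x ⬝ᵥ y := by
  simp only [npaeMean, gpMean_localData]
  rw [npaeWeights, ← dotProduct_mulVec, dotProduct_mulVec, ← mulVec_transpose,
    ← conjTranspose_eq_transpose_of_trivial, (npaeMat_posDef θ X x hn).isHermitian.inv.eq]

lemma predErr_vecMul_agentWeights (u : Fin M → ℝ) :
    predErr θ X x (u ᵥ* agentWeights θ X x) =
      seKernel θ x x - 2 * (u ⬝ᵥ npaeVec θ X x) + u ⬝ᵥ (npaeMat θ X x *ᵥ u) := by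
  rw [predErr_eq, ← dotProduct_mulVec, ← npaeVec_eq, ← dotProduct_mulVec, npaeMat_eq,
    ← mulVec_mulVec, ← mulVec_mulVec, mulVec_transpose]

/-- Completing the square in `u` shows that the aggregate is optimal among combinations of the local
predictors. -/
lemma npaeVar_add (hn : 0 < n) (u : Fin M → ℝ) :
    predErr θ X x (u ᵥ* agentWeights θ X x) = npaeVar θ X x +
      (u - (npaeMat θ X x)⁻¹ *ᵥ npaeVec θ X x) ⬝ᵥ
        (npaeMat θ X x *ᵥ (u - (npaeMat θ X x)⁻¹ *ᵥ npaeVec θ X x)) := by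
  have := (npaeMat_posDef θ X x hn).dotProduct_mulVec_sub_two_mul (npaeVec θ X x) u
  rw [predErr_vecMul_agentWeights, npaeVar]
  linarith

lemma npaeVar_eq_predErr (hn : 0 < n) : npaeVar θ X x = predErr θ X x (npaeWeights θ X x) := by
  simp [npaeWeights, npaeVar_add hn]

/-- The aggregated predictor is at least as good as the one of any agent. -/
lemma npaeVar_le_gpVar (hn : 0 < n) (i : Fin M) :
    npaeVar θ X x ≤ gpVar θ (localData X i) x := by
  -- Compare with the combination using agent `i` alone; its error is the local posterior variance
  -- because `[C_A]_ii = [k_A]_i`.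
  have h := (npaeMat_posDef θ X x hn).posSemidef.dotProduct_mulVec_nonneg
    (Pi.single i 1 - (npaeMat θ X x)⁻¹ *ᵥ npaeVec θ X x)
  have h1 := npaeVar_add (θ := θ) (X := X) (x := x) hn (Pi.single i 1)
  rw [predErr_vecMul_agentWeights, single_one_dotProduct, single_one_dotProduct,
    mulVec_single_one, col_apply, npaeMat_self] at h1
  rw [star_trivial] at h
  have h2 : gpVar θ (localData X i) x = seKernel θ x x - npaeVec θ X x i := rfl
  linarith

lemma gpVar_le_npaeVar (hn : 0 < n) : gpVar θ X x ≤ npaeVar θ X x :=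
  npaeVar_eq_predErr (θ := θ) (X := X) (x := x) hn ▸ gpVar_le_predErr θ X x _

/-- The variance of the difference of the two predictors is the difference of their errors. -/
lemma npaeVar_sub_gpVar (hn : 0 < n) : npaeVar θ X x - gpVar θ X x =
    (gpWeights θ X x - npaeWeights θ X x) ⬝ᵥ
      (covMat θ X *ᵥ (gpWeights θ X x - npaeWeights θ X x)) := by
  rw [npaeVar_eq_predErr hn, predErr_eq_gpVar_add, ← neg_sub (npaeWeights θ X x), mulVec_neg,
    neg_dotProduct_neg, gpWeights]
  ring

end Npae

/-! ### Second moments of the observations -/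

lemma eLpNorm_two_eq_sqrt_variance {Ω : Type*} [MeasurableSpace Ω] {P : Measure Ω} {Z : Ω → ℝ}
    (hZ : MemLp Z 2 P) (h0 : ∫ ω, Z ω ∂P = 0) :
    eLpNorm Z 2 P = ENNReal.ofReal √(Var[Z; P]) := by
  rw [hZ.eLpNorm_eq_integral_rpow_norm two_ne_zero ENNReal.ofNat_ne_top,
    variance_of_integral_eq_zero hZ.aemeasurable h0, Real.sqrt_eq_rpow]
  simp

section Observations

variable {Ω : Type*} [MeasurableSpace Ω] {P : Measure Ω} {D : ℕ}
  {θ : Hyperparameters D} {M : ℕ} {X : (n : ℕ) → Fin M × Fin n → EuclideanSpace ℝ (Fin D)}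
  {f : EuclideanSpace ℝ (Fin D) → Ω → ℝ} {ε y : (n : ℕ) → Fin M × Fin n → Ω → ℝ}

namespace ObservationModel

lemma memLp_signal (h : ObservationModel P θ X f ε y) (x : EuclideanSpace ℝ (Fin D)) :
    MemLp (f x) 2 P :=
  (h.gaussian.hasGaussianLaw_eval x).memLp_two

lemma memLp_noise (h : ObservationModel P θ X f ε y) (n : ℕ) (p : Fin M × Fin n) :
    MemLp (ε n p) 2 P := by
  have hl := h.noise_law n p
  have : MemLp id 2 (P.map (ε n p)) := hl.map_eq ▸ IsGaussian.memLp_two_id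
  exact (memLp_map_measure_iff aestronglyMeasurable_id hl.aemeasurable).1 this

lemma obs_eq (h : ObservationModel P θ X f ε y) (n : ℕ) (p : Fin M × Fin n) :
    y n p = f (X n p) + ε n p :=
  funext (h.obs n p)

lemma memLp_obs (h : ObservationModel P θ X f ε y) (n : ℕ) (p : Fin M × Fin n) :
    MemLp (y n p) 2 P :=
  h.obs_eq n p ▸ (h.memLp_signal _).add (h.memLp_noise n p)

lemma covariance_noise (h : ObservationModel P θ X f ε y) (n : ℕ) (p q : Fin M × Fin n) :
    cov[ε n p, ε n q; P] = if p = q then θ.sigmaE ^ 2 else 0 := by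
  split_ifs with hpq
  · subst hpq
    rw [covariance_self (h.memLp_noise n p).aemeasurable, (h.noise_law n p).variance_eq,
      variance_id_gaussianReal, Real.coe_toNNReal _ (sq_nonneg _)]
  · exact ((h.noise_indep n).indepFun hpq).covariance_eq_zero (h.memLp_noise n p)
      (h.memLp_noise n q)

lemma covariance_signal_noise (h : ObservationModel P θ X f ε y) (n : ℕ)
    (x : EuclideanSpace ℝ (Fin D)) (p : Fin M × Fin n) : cov[f x, ε n p; P] = 0 := by
  have hind := (h.noise_indep_signal n).comp (measurable_pi_apply x) (measurable_pi_apply p)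
  exact IndepFun.covariance_eq_zero hind (h.memLp_signal x) (h.memLp_noise n p)

variable [IsProbabilityMeasure P]

lemma integral_obs (h : ObservationModel P θ X f ε y) (n : ℕ) (p : Fin M × Fin n) :
    ∫ ω, y n p ω ∂P = 0 := by
  simp only [h.obs]
  rw [integral_add ((h.memLp_signal _).integrable one_le_two)
    ((h.memLp_noise n p).integrable one_le_two), h.centred, (h.noise_law n p).integral_eq,
    integral_id_gaussianReal, add_zero]

lemma covariance_obs (h : ObservationModel P θ X f ε y) (n : ℕ) (p q : Fin M × Fin n) :
    cov[y n p, y n q; P] = covMat θ (X n) p q := by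
  have hf := h.memLp_signal
  have hε := h.memLp_noise n
  rw [h.obs_eq, h.obs_eq, covariance_add_left (hf _) (hε p) ((hf _).add (hε q)),
    covariance_add_right (hf _) (hf _) (hε q), covariance_add_right (hε p) (hf _) (hε q),
    covariance_comm (ε n p), h.covariance_signal_noise, h.covariance_signal_noise,
    h.covariance, h.covariance_noise]
  simp [covMat, one_apply]

/-- The combination is centred, so its norm is its standard deviation, expanded by bilinearity of
covariance. -/
lemma eLpNorm_dotProduct_obs (h : ObservationModel P θ X f ε y) (n : ℕ) (d : Fin M × Fin n → ℝ) :
    eLpNorm (fun ω => d ⬝ᵥ fun p => y n p ω) 2 P =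
      ENNReal.ofReal √(d ⬝ᵥ (covMat θ (X n) *ᵥ d)) := by
  have hm : ∀ p, MemLp (fun ω => d p * y n p ω) 2 P := fun p => (h.memLp_obs n p).const_mul _
  have hsum : MemLp (fun ω => ∑ p, d p * y n p ω) 2 P := memLp_finsetSum _ fun p _ => hm p
  have h0 : ∫ ω, ∑ p, d p * y n p ω ∂P = 0 := by
    rw [integral_finsetSum _ fun p _ => (hm p).integrable one_le_two]
    simp [integral_const_mul, h.integral_obs]
  simp only [dotProduct, mulVec]
  rw [eLpNorm_two_eq_sqrt_variance hsum h0, ← covariance_self hsum.aemeasurable,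
    covariance_fun_sum_fun_sum hm hm]
  congr 2
  refine Finset.sum_congr rfl fun p _ => ?_
  rw [Finset.mul_sum]
  refine Finset.sum_congr rfl fun q _ => ?_
  rw [covariance_const_mul_left, covariance_const_mul_right, h.covariance_obs]
  ring

end ObservationModel

end Observations

/-! ### Consistency -/

lemma sum_coe_of_forall_mem {ι : Type*} [Fintype ι] {S : Finset ι} (hS : ∀ i, i ∈ S)
    (g : ι → ℝ) : ∑ i : S, g i = ∑ i, g i := by
  rw [Finset.sum_coe_sort S g, Finset.eq_univ_iff_forall.2 hS]

lemma submatrix_val_mulVec {ι : Type*} [Fintype ι] {S : Finset ι} (hS : ∀ i, i ∈ S)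
    (A : Matrix ι ι ℝ) (v : ι → ℝ) :
    A.submatrix Subtype.val Subtype.val *ᵥ (fun i : S => v i) = fun i : S => (A *ᵥ v) i := by
  ext i
  exact sum_coe_of_forall_mem hS fun j => A i j * v j

/-- When all the agents are selected, DEC-NN-NPAE outputs the aggregated mean and variance. -/
lemma isDecNNNPAEOutput_of_forall_mem_cbnn {D : ℕ} {θ : Hyperparameters D} {η : ℝ} {M n : ℕ}
    {G : ℕ → SimpleGraph (Fin M)} (hG : RepeatedlyConnected G)
    {X : Fin M × Fin n → EuclideanSpace ℝ (Fin D)} {x : EuclideanSpace ℝ (Fin D)} (hn : 0 < n)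
    (hS : ∀ i, i ∈ cbnn θ η X x) (y : Fin M × Fin n → ℝ) :
    IsDecNNNPAEOutput θ η G X y x (npaeMean θ X x y) (npaeVar θ X x) := by
  obtain ⟨γ, hγ, hconn⟩ := hG
  have hpos := npaeMat_posDef θ X x hn
  have hinj : ∀ v, (npaeMat θ X x).submatrix (Subtype.val : cbnn θ η X x → Fin M)
      (Subtype.val : cbnn θ η X x → Fin M) *ᵥ v = 0 → v = 0 := by
    intro v hv
    by_contra hne
    have := (hpos.submatrix (e := (Subtype.val : cbnn θ η X x → Fin M))
      Subtype.val_injective).dotProduct_mulVec_pos hne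
    simp [hv] at this
  have hlim : ∀ (b : Fin M → ℝ) (q₀ : cbnn θ η X x → cbnn θ η X x → ℝ) (i : cbnn θ η X x),
      Tendsto (fun s => dale ((npaeMat θ X x).submatrix Subtype.val Subtype.val)
        (fun i : cbnn θ η X x => b i) (nbhd G (cbnn θ η X x)) q₀ s i) atTop
        (𝓝 fun i => ((npaeMat θ X x)⁻¹ *ᵥ b) i) := by
    intro b q₀ i
    refine tendsto_dale hinj ?_ (mem_nbhd_self G _) hγ
      (fun t A hA hcl => eq_univ_of_nbhd_closed hS (hconn t) hA hcl) q₀ i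
    rw [submatrix_val_mulVec hS, hpos.mulVec_inv_mulVec]
  have hdot : ∀ u v : Fin M → ℝ,
      (fun i : cbnn θ η X x => u i) ⬝ᵥ (fun i => v i) = u ⬝ᵥ v := fun u v =>
    sum_coe_of_forall_mem hS fun i => u i * v i
  obtain ⟨i₀⟩ := (hconn 0).nonempty
  refine ⟨⟨i₀, hS i₀⟩, _, _,
    hlim fun i => gpMean θ (localData X i) (localData y i) x, hlim (npaeVec θ X x), ?_, ?_⟩
  · rw [hdot, npaeMean]
  · rw [hdot, npaeVar]

lemma seKernel_self {D : ℕ} (θ : Hyperparameters D) (x : EuclideanSpace ℝ (Fin D)) :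
    seKernel θ x x = θ.sigmaF ^ 2 := by
  simp [seKernel]

theorem mainTheorem2 {Ω : Type*} [MeasurableSpace Ω] (P : Measure Ω) [IsProbabilityMeasure P]
    {D : ℕ} (hD : 0 < D) (θ : Hyperparameters D) {M : ℕ}
    (G : ℕ → SimpleGraph (Fin M)) (hG : RepeatedlyConnected G)
    (η : ℝ) (hη : η < θ.sigmaF ^ 2)
    (X : (n : ℕ) → Fin M × Fin n → EuclideanSpace ℝ (Fin D))
    (hX : ∀ i : Fin M, FillsRegion (fun n => localData (X n) i))
    (f : EuclideanSpace ℝ (Fin D) → Ω → ℝ) (ε y : (n : ℕ) → Fin M × Fin n → Ω → ℝ)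
    (hmodel : ObservationModel P θ X f ε y) :
    ∃ (meanNN : ℕ → EuclideanSpace ℝ (Fin D) → Ω → ℝ)
      (varNN : ℕ → EuclideanSpace ℝ (Fin D) → ℝ),
      (∀ x, ∀ᶠ n in atTop, ∀ ω,
        IsDecNNNPAEOutput θ η G (X n) (fun p => y n p ω) x (meanNN n x ω) (varNN n x)) ∧
      IsConsistent P
        (fun n x ω => gpMean θ (X n) (fun p => y n p ω) x) meanNN
        (fun n x => gpVar θ (X n) x) varNN := by
  have hlocal : ∀ x i, Tendsto (fun n => gpVar θ (localData (X n) i) x) atTop (𝓝 0) :=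
    fun x i => tendsto_gpVar_of_fillsRegion hD θ (hX i) x
  -- The aggregate of all agents serves for every `n`; it has to be the algorithm's output only for
  -- large `n`.
  refine ⟨fun n x ω => npaeMean θ (X n) x fun p => y n p ω, fun n x => npaeVar θ (X n) x,
    fun x => ?_, fun x => ?_⟩
  · have hsel : ∀ᶠ n in atTop, ∀ i, gpVar θ (localData (X n) i) x < θ.sigmaF ^ 2 - η :=
      eventually_all.2 fun i => (hlocal x i).eventually_lt_const (sub_pos.2 hη)
    filter_upwards [hsel, eventually_gt_atTop 0] with n hn hn0 ω
    refine isDecNNNPAEOutput_of_forall_mem_cbnn hG hn0 (fun i => ?_) _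
    have h : gpVar θ (localData (X n) i) x = seKernel θ x x - npaeVec θ (X n) x i := rfl
    have h' := hn i
    rw [h, seKernel_self] at h'
    simp only [cbnn, Finset.mem_filter, Finset.mem_univ, true_and]
    linarith
  · obtain ⟨i⟩ : Nonempty (Fin M) := by
      obtain ⟨γ, -, hconn⟩ := hG
      exact (hconn 0).nonempty
    -- The gap is nonnegative and at most the posterior variance of the single agent `i`.
    have hdiff : Tendsto (fun n => npaeVar θ (X n) x - gpVar θ (X n) x) atTop (𝓝 0) := by
      refine squeeze_zero' ?_ ?_ (hlocal x i)
      · filter_upwards [eventually_gt_atTop 0] with n hn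
        exact sub_nonneg.2 (gpVar_le_npaeVar hn)
      · filter_upwards [eventually_gt_atTop 0] with n hn
        exact (sub_le_self _ (gpVar_nonneg θ (X n) x)).trans (npaeVar_le_gpVar hn i)
    constructor
    · have h : Tendsto (fun n => ENNReal.ofReal √(npaeVar θ (X n) x - gpVar θ (X n) x)) atTop
          (𝓝 0) := by
        have := (ENNReal.continuous_ofReal.comp Real.continuous_sqrt).tendsto 0 |>.comp hdiff
        simpa [Function.comp_def] using this
      refine h.congr' ?_
      filter_upwards [eventually_gt_atTop 0] with n hn
      rw [npaeVar_sub_gpVar hn, ← hmodel.eLpNorm_dotProduct_obs]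
      simp only [gpMean_eq_gpWeights_dotProduct θ (X n), npaeMean_eq_npaeWeights_dotProduct hn,
        sub_dotProduct]
    · simpa using hdiff.neg
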